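/- Let $d,\alpha\in\mathbb N=\{1,2,\dots\}$ and let $\rho(x)=(2\pi)^{-d/2}e^{-|x|^2/2}$ on $\mathbb R^d$. Let $H_\rho^\alpha=H_\rho^\alpha(\mathbb R^d)$ be the space of functions with norm $$\|f\|_{H_\rho^\alpha}=\Big(\sum_{|\mathbf r|_\infty\le\alpha}\|D^{\mathbf r}f\|_{L^2_\rho(\mathbb R^d)}^2\Big)^{1/2}<\infty ,$$ where $D^{\mathbf r}f$ are weak derivatives, $\mathbf r\in\mathbb N_0^d$, and $\|g\|_{L^2_\rho(\mathbb R^d)}^2=\int_{\mathbb R^d}|g|^2\rho\,dx$; point values of $f$ are those of its continuous representative. Let $I(f)=\int_{\mathbb R^d}f\rho\,dx$. For integers $n_\ell\ge1$ ($\ell\ge1$) let $Q_\ell$ be the univariate Gauss–Hermite rule with $n_\ell$ points, i.e. the interpolatory quadrature rule for the standard Gaussian weight on $\mathbb R$ whose nodes are the zeros of the Hermite polynomial of degree $n_\ell$ orthogonal with respect to this weight. Put $Q_0=0$, $\Delta_\ell=Q_\ell-Q_{\ell-1}$ for $\ell\ge1$, and $$S_{\Lambda_L}=\sum_{\boldsymbol\ell\in\Lambda_L}\Delta_{\ell_1}\otimes\dots\otimes\Delta_{\ell_d},\qquad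 \Lambda_L=\{\boldsymbol\ell\in\mathbb N^d:\ \ell_1+\dots+\ell_d\le L\}.$$ Let $M>1$ and $M_0>0$. There is a constant $c=c_{\alpha,d}>0$, which may also depend on the fixed parameters $M$ and $M_0$, but on neither the sequence $(n_\ell)$ nor $L$ nor $N$, such that the following holds. If $$M^{\ell-1}\le n_\ell\le M_0(M^\ell-1)\quad\text{for all }\ell\ge1,\qquad L\ge d,\qquad n_{L-d+1}\ge e^{d-1},$$ and $N$ is the total number of function evaluations used in $S_{\Lambda_L}$, then $$\sup_{0\ne f\in H_\rho^\alpha}\frac{|I(f)-S_{\Lambda_L}(f)|}{\|f\|_{H_\rho^\alpha}}\ \ge\ c\,N^{-\alpha/2}(\ln N)^{\frac{\alpha}{2}(d-1)} .$$ Here $N$ may be the number $\sum_{\boldsymbol\ell\in\Lambda_L}\prod_{k=1}^d n_{\ell_k}$ of evaluations on the tensor grids with levels $\boldsymbol\ell\in\Lambda_L$, counted with multiplicity, or the number of distinct points in the union of these grids, or any integer between the two. -/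

import Mathlib

open MeasureTheory ProbabilityTheory
open scoped ENNReal ContDiff

namespace GaussianSobolev

/-- The standard Gaussian measure on `ℝ^d`, that is, the measure with density
`ρ(x) = exp (-|x|² / 2) / (2π)^(d/2)`, as the `d`-fold product of `N(0, 1)`. -/
noncomputable def gaussianMeasure (d : ℕ) : Measure (Fin d → ℝ) :=
  Measure.pi fun _ => gaussianReal 0 1

/-- The classical partial derivative in the `i`-th coordinate. -/
noncomputable def partialDeriv {d : ℕ} (i : Fin d) (φ : (Fin d → ℝ) → ℝ) : (Fin d → ℝ) → ℝ :=
  fun x => fderiv ℝ φ x (Pi.single i 1)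

/-- The classical mixed partial derivative `D^r φ = ∂₁^(r₁) ⋯ ∂_d^(r_d) φ`; it is only applied
to smooth functions, so that the order of differentiation is immaterial. -/
noncomputable def mixedDeriv {d : ℕ} (r : Fin d → ℕ) (φ : (Fin d → ℝ) → ℝ) : (Fin d → ℝ) → ℝ :=
  (List.finRange d).foldr (fun i g => (partialDeriv i)^[r i] g) φ

/-- `g` is a weak derivative `D^r f` of `f` on `ℝ^d`:
`∫ f D^r φ = (-1)^|r| ∫ g φ` for all test functions `φ`. -/
def HasWeakDeriv {d : ℕ} (r : Fin d → ℕ) (f g : (Fin d → ℝ) → ℝ) : Prop :=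
  LocallyIntegrable f ∧ LocallyIntegrable g ∧
    ∀ φ : (Fin d → ℝ) → ℝ, ContDiff ℝ ∞ φ → HasCompactSupport φ →
      ∫ x, f x * mixedDeriv r φ x = (-1) ^ (∑ i, r i) * ∫ x, g x * φ x

/-- `‖D^r f‖` in `L²_ρ(ℝ^d)`. The weak derivative is unique up to null sets, so the infimum is
over one value if the weak derivative exists; it is `∞` if there is no weak derivative. -/
noncomputable def weakDerivNorm {d : ℕ} (r : Fin d → ℕ) (f : (Fin d → ℝ) → ℝ) : ℝ≥0∞ :=
  ⨅ (g : (Fin d → ℝ) → ℝ) (_ : HasWeakDeriv r f g), eLpNorm g 2 (gaussianMeasure d)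

/-- The norm of `H_ρ^α(ℝ^d)`, `(∑_{|r|_∞ ≤ α} ‖D^r f‖²_{L²_ρ})^(1/2)`, with value `∞` on the
functions outside the space. -/
noncomputable def sobolevNorm {d : ℕ} (α : ℕ) (f : (Fin d → ℝ) → ℝ) : ℝ≥0∞ :=
  (∑ r ∈ Fintype.piFinset (fun _ : Fin d => Finset.range (α + 1)), weakDerivNorm r f ^ 2) ^
    (1 / 2 : ℝ)

/-- The Gaussian Sobolev space `H_ρ^α(ℝ^d)` of dominating mixed smoothness, `α ≥ 1`. Every class
has exactly one continuous representative, through which point values are defined; the space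
is given here as the set of these representatives. -/
def sobolevSpace (d α : ℕ) : Set ((Fin d → ℝ) → ℝ) :=
  {f | Continuous f ∧ sobolevNorm α f < ⊤}

/-- The integral `I(f) = ∫ f ρ`. -/
noncomputable def gaussianIntegral {d : ℕ} (f : (Fin d → ℝ) → ℝ) : ℝ :=
  ∫ x, f x ∂(gaussianMeasure d)

/-- The worst-case error `sup_{f ≠ 0} |I(f) - A(f)| / ‖f‖` of `A` over `H_ρ^α(ℝ^d)`. -/
noncomputable def worstCaseError {d : ℕ} (α : ℕ) (A : ((Fin d → ℝ) → ℝ) → ℝ) : ℝ≥0∞ :=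
  ⨆ f ∈ {f ∈ sobolevSpace d α | f ≠ 0},
    ENNReal.ofReal |gaussianIntegral f - A f| / sobolevNorm α f

/-- The zeros of the `n`-th probabilists' Hermite polynomial. -/
noncomputable def hermiteNodes (n : ℕ) : Finset ℝ :=
  ((Polynomial.hermite n).map (Int.castRingHom ℝ)).roots.toFinset

/-- A univariate quadrature functional `f ↦ ∑ w_ξ f(ξ)` is represented by the finitely supported
function `ξ ↦ w_ξ`. This is the `n`-point Gauss–Hermite rule: the interpolatory rule for the
standard Gaussian weight at the zeros of the Hermite polynomial of degree `n`. -/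
noncomputable def gaussHermite (n : ℕ) : ℝ →₀ ℝ :=
  ∑ ξ ∈ hermiteNodes n, Finsupp.single ξ
    (∫ x, (Lagrange.basis (hermiteNodes n) id ξ).eval x ∂(gaussianReal 0 1))

/-- `Q_ℓ`: zero for `ℓ = 0`, the Gauss–Hermite rule with `n ℓ` points for `ℓ ≥ 1`. -/
noncomputable def univariateRule (n : ℕ → ℕ) (ℓ : ℕ) : ℝ →₀ ℝ :=
  if ℓ = 0 then 0 else gaussHermite (n ℓ)

/-- `Δ_0 = 0` and `Δ_ℓ = Q_ℓ - Q_(ℓ-1)` for `ℓ ≥ 1`. -/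
noncomputable def ruleDifference (n : ℕ → ℕ) (ℓ : ℕ) : ℝ →₀ ℝ :=
  if ℓ = 0 then 0 else univariateRule n ℓ - univariateRule n (ℓ - 1)

/-- The tensor product of the quadrature functionals `T_1, …, T_d`, acting on functions on `ℝ^d`:
`(T_1 ⊗ ⋯ ⊗ T_d)(f) = ∑_{x_1, …, x_d} T_1(x_1) ⋯ T_d(x_d) f(x_1, …, x_d)`. -/
noncomputable def tensorRule {d : ℕ} (T : Fin d → ℝ →₀ ℝ) (f : (Fin d → ℝ) → ℝ) : ℝ :=
  ∑ x ∈ Fintype.piFinset (fun k => (T k).support), (∏ k, T k (x k)) * f x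

/-- On products of univariate functions the tensor product functional is the product of the values
of its factors. -/
theorem tensorRule_prod {d : ℕ} (T : Fin d → ℝ →₀ ℝ) (g : Fin d → ℝ → ℝ) :
    tensorRule T (fun x => ∏ k, g k (x k)) = ∏ k, (T k).sum fun ξ w => w * g k ξ := by
  simp only [tensorRule, Finsupp.sum, Finset.prod_univ_sum, Finset.prod_mul_distrib]

/-- The sparse-grid quadrature `S_Λ = ∑_{ℓ ∈ Λ} Δ_(ℓ_1) ⊗ ⋯ ⊗ Δ_(ℓ_d)`. -/
noncomputable def sparseGridRule {d : ℕ} (n : ℕ → ℕ) (Λ : Finset (Fin d → ℕ))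
    (f : (Fin d → ℝ) → ℝ) : ℝ :=
  ∑ ℓ ∈ Λ, tensorRule (fun k => ruleDifference n (ℓ k)) f

/-- The isotropic index set `Λ_L = {ℓ ∈ ℕ^d : ℓ_k ≥ 1 for all k, ℓ_1 + ⋯ + ℓ_d ≤ L}`. -/
def isotropicIndexSet (d L : ℕ) : Finset (Fin d → ℕ) :=
  {ℓ ∈ Fintype.piFinset (fun _ : Fin d => Finset.Icc 1 L) | ∑ k, ℓ k ≤ L}

/-- The sparse grid: the set of all points of the tensor grids of levels `ℓ ∈ Λ`. -/
noncomputable def sparseGrid {d : ℕ} (n : ℕ → ℕ) (Λ : Finset (Fin d → ℕ)) :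
    Finset (Fin d → ℝ) :=
  Λ.biUnion fun ℓ => Fintype.piFinset fun k => hermiteNodes (n (ℓ k))

/-- The number `∑_{ℓ ∈ Λ} n_(ℓ_1) ⋯ n_(ℓ_d)` of evaluations on the tensor grids of levels `ℓ ∈ Λ`,
counted with multiplicity. -/
def evaluationCount {d : ℕ} (n : ℕ → ℕ) (Λ : Finset (Fin d → ℕ)) : ℕ :=
  ∑ ℓ ∈ Λ, ∏ k, n (ℓ k)

end GaussianSobolev

namespace GaussianSobolev

/-! The bound already comes from functions of a single coordinate. Each `Δ_ℓ` with `ℓ ≥ 2`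
annihilates constants, so on such functions the sparse-grid rule telescopes to the univariate
Gauss–Hermite rule with `n = n_(L-d+1)` points (`sparseGridRule_comp_zero`).

That rule has error of order at least `n^(-α/2)`. By a Sturm-type argument the zeros of the Hermite
polynomial in `[0, 1]` are at least about `n^(-1/2)` apart (`one_le_mul_sq_of_mem_hermiteNodes`).
Hence each of `m ~ √n` equal cells of `[0, 1]` has a half without nodes. A sum of bumps on these
halves vanishes at all nodes, has Gaussian integral bounded below, and has derivatives up to order
`α` of size at most `n^(α/2)` up to a constant (`exists_fooling_function`).

It remains to compare `n` with `N`. Here `n` is at most of order `M^L`, while the grid has at least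
of order `L^(d-1) M^L` distinct points (`exists_le_card_sparseGrid`), and `ln N` is at most of order
`L` (`exists_log_le`). So `(ln N)^(d-1) / N` is at most a constant times `1 / n`, and the power
`α/2` gives the claim. The lower count must hold without multiplicity although zeros of different
degrees can coincide; `newNodes` deals with this. -/

/-! ### Hermite polynomials and the separation of their zeros. -/

/-- The probabilists' Hermite polynomial with real coefficients. -/
noncomputable def realHermite (n : ℕ) : Polynomial ℝ :=
  (Polynomial.hermite n).map (Int.castRingHom ℝ)

theorem realHermite_succ (n : ℕ) :
    realHermite (n + 1) = Polynomial.X * realHermite n - (realHermite n).derivative := by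
  simp [realHermite, Polynomial.hermite_succ, Polynomial.derivative_map]

theorem realHermite_monic (n : ℕ) : (realHermite n).Monic :=
  (Polynomial.hermite_monic n).map _

theorem natDegree_realHermite (n : ℕ) : (realHermite n).natDegree = n := by
  rw [realHermite, (Polynomial.hermite_monic n).natDegree_map, Polynomial.natDegree_hermite]

theorem mem_hermiteNodes {n : ℕ} {x : ℝ} : x ∈ hermiteNodes n ↔ (realHermite n).eval x = 0 := by
  rw [hermiteNodes, Multiset.mem_toFinset]
  exact Polynomial.mem_roots (realHermite_monic n).ne_zero

/-- Hermite's differential equation. -/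
theorem realHermite_derivative_derivative (n : ℕ) :
    (realHermite n).derivative.derivative =
      Polynomial.X * (realHermite n).derivative - (n : Polynomial ℝ) * realHermite n := by
  induction n with
  | zero => simp [realHermite]
  | succ n ih =>
    -- The induction hypothesis is used only for this Appell relation; differentiating it once more
    -- gives the equation.
    have h1 : (realHermite (n + 1)).derivative = ((n : Polynomial ℝ) + 1) * realHermite n := by
      rw [realHermite_succ, Polynomial.derivative_sub, Polynomial.derivative_mul,
        Polynomial.derivative_X, ih]
      ring
    rw [h1, Polynomial.derivative_mul, realHermite_succ]
    simp
    ring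

/-- At an interior maximum `z` of `|u|` the derivative vanishes. Two applications of the mean value
inequality, starting from `z`, give `|u z| = |u b - u z| ≤ K |u z| (b - a)²`, and `|u z|` cancels.
-/
theorem one_le_mul_sq_of_abs_deriv_deriv_le {u u' u'' : ℝ → ℝ} (hu : ∀ x, HasDerivAt u (u' x) x)
    (hu' : ∀ x, HasDerivAt u' (u'' x) x) {a b K : ℝ} (ha : u a = 0) (hb : u b = 0)
    (hne : ∃ x ∈ Set.Icc a b, u x ≠ 0) (hK : 0 ≤ K)
    (hbound : ∀ x ∈ Set.Icc a b, |u'' x| ≤ K * |u x|) : 1 ≤ K * (b - a) ^ 2 := by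
  obtain ⟨c, hc, hcu⟩ := hne
  have hcont : Continuous u := continuous_iff_continuousAt.2 fun x => (hu x).continuousAt
  obtain ⟨z, hz, hmax⟩ := isCompact_Icc.exists_isMaxOn ⟨c, hc⟩ hcont.abs.continuousOn
  have hpos : 0 < |u z| := (abs_pos.2 hcu).trans_le (hmax hc)
  have hza : a < z := lt_of_le_of_ne hz.1 (by rintro rfl; simp [ha] at hpos)
  have hzb : z < b := lt_of_le_of_ne hz.2 (by rintro rfl; simp [hb] at hpos)
  have hloc : IsLocalMax (fun x => u x ^ 2) z := by
    filter_upwards [Icc_mem_nhds hza hzb] with x hx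
    exact sq_le_sq.2 (hmax hx)
  have hd : u' z = 0 := by
    have := hloc.hasDerivAt_eq_zero ((hu z).pow 2)
    simpa [abs_pos.1 hpos] using this
  have hba : 0 ≤ b - a := by linarith
  have h1 : ∀ t ∈ Set.Icc a b, |u' t| ≤ K * |u z| * (b - a) := by
    intro t ht
    have := (convex_Icc a b).norm_image_sub_le_of_norm_hasDerivWithin_le
      (f := u') (f' := u'') (C := K * |u z|) (fun x _ => (hu' x).hasDerivWithinAt)
      (fun x hx => (hbound x hx).trans (mul_le_mul_of_nonneg_left (hmax hx) hK)) hz ht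
    rw [hd, sub_zero] at this
    refine this.trans (mul_le_mul_of_nonneg_left ?_ (by positivity))
    rw [Real.norm_eq_abs, abs_le]
    constructor <;> linarith [ht.1, ht.2]
  have h2 := (convex_Icc a b).norm_image_sub_le_of_norm_hasDerivWithin_le
      (f := u) (f' := u') (C := K * |u z| * (b - a)) (fun x _ => (hu x).hasDerivWithinAt)
      h1 hz (Set.right_mem_Icc.2 (by linarith))
  rw [hb, zero_sub, norm_neg, Real.norm_eq_abs, Real.norm_eq_abs,
    abs_of_nonneg (sub_nonneg.2 hz.2)] at h2
  have h3 : |u z| * 1 ≤ |u z| * (K * (b - a) ^ 2) := by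
    rw [mul_one]
    refine h2.trans ?_
    calc K * |u z| * (b - a) * (b - z) ≤ K * |u z| * (b - a) * (b - a) :=
          mul_le_mul_of_nonneg_left (by linarith) (by positivity)
      _ = _ := by ring
  exact le_of_mul_le_mul_left h3 hpos

theorem exists_mem_Ioo_eval_ne_zero {p : Polynomial ℝ} (hp : p ≠ 0) {a b : ℝ} (hab : a < b) :
    ∃ x ∈ Set.Ioo a b, p.eval x ≠ 0 := by
  obtain ⟨x, hx, hx'⟩ := (Set.Ioo_infinite hab).exists_notMem_finset p.roots.toFinset
  refine ⟨x, hx, fun h => hx' ?_⟩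
  rw [Multiset.mem_toFinset]
  exact (Polynomial.mem_roots hp).2 h

/-- In `[0, 1]` the zeros of the Hermite polynomial of degree `n` are at least
`(n + 1 / 2)^(-1/2)` apart. -/
theorem one_le_mul_sq_of_mem_hermiteNodes {n : ℕ} {a b : ℝ} (ha0 : 0 ≤ a) (hab : a < b)
    (hb1 : b ≤ 1) (ha : a ∈ hermiteNodes n) (hb : b ∈ hermiteNodes n) :
    1 ≤ ((n : ℝ) + 1 / 2) * (b - a) ^ 2 := by
  rw [mem_hermiteNodes] at ha hb
  have hexp : ∀ x : ℝ, HasDerivAt (fun x : ℝ => Real.exp (-(x ^ 2) / 4))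
      (Real.exp (-(x ^ 2) / 4) * (-x / 2)) x := fun x => by
    have : HasDerivAt (fun x : ℝ => -(x ^ 2) / 4) (-x / 2) x := by
      refine (((hasDerivAt_id' x).fun_pow 2).fun_neg.div_const 4).congr_deriv ?_
      simp; ring
    exact this.exp
  set p := realHermite n with hp
  -- The weight `exp (-x²/4)` removes the first-order term of Hermite's equation: `u'' = (x²/4 - (n
  -- + 1/2)) u`, and on `[0, 1]` the coefficient is at most `n + 1/2` in absolute value.
  refine one_le_mul_sq_of_abs_deriv_deriv_le
    (u := fun x => p.eval x * Real.exp (-(x ^ 2) / 4))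
    (u' := fun x => (p.derivative - Polynomial.C (1 / 2) * Polynomial.X * p).eval x *
      Real.exp (-(x ^ 2) / 4))
    (u'' := fun x => (x ^ 2 / 4 - (n + 1 / 2)) * (p.eval x * Real.exp (-(x ^ 2) / 4)))
    ?_ ?_ ?_ ?_ ?_ ?_ ?_
  · intro x
    refine ((p.hasDerivAt x).fun_mul (hexp x)).congr_deriv ?_
    simp; ring
  · intro x
    refine (((p.derivative - Polynomial.C (1 / 2) * Polynomial.X * p).hasDerivAt x).fun_mul
      (hexp x)).congr_deriv ?_
    simp [hp, realHermite_derivative_derivative]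
    ring
  · simp [ha]
  · simp [hb]
  · obtain ⟨x, hx, hx'⟩ := exists_mem_Ioo_eval_ne_zero (realHermite_monic n).ne_zero hab
    exact ⟨x, Set.Ioo_subset_Icc_self hx, mul_ne_zero hx' (Real.exp_ne_zero _)⟩
  · positivity
  · intro x hx
    rw [abs_mul]
    refine mul_le_mul_of_nonneg_right ?_ (abs_nonneg _)
    have h0 : 0 ≤ x := ha0.trans hx.1
    have h1 : x ≤ 1 := hx.2.trans hb1
    have h2 : x ^ 2 ≤ 1 := pow_le_one₀ h0 h1
    rw [abs_le]
    constructor <;> nlinarith [sq_nonneg x, (Nat.cast_nonneg n : (0:ℝ) ≤ n)]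

/-! ### Interlacing and the number of zeros. -/

theorem tendsto_eval_mul_exp_neg_sq_atTop (p : Polynomial ℝ) :
    Filter.Tendsto (fun x => p.eval x * Real.exp (-(x ^ 2))) Filter.atTop (nhds 0) := by
  have h := (p.tendsto_div_exp_atTop).norm
  rw [norm_zero] at h
  refine squeeze_zero_norm' ?_ h
  filter_upwards [Filter.eventually_ge_atTop 1] with x hx
  rw [norm_mul, norm_div, div_eq_mul_inv]
  refine mul_le_mul_of_nonneg_left ?_ (norm_nonneg _)
  rw [Real.norm_eq_abs, Real.norm_eq_abs, Real.abs_exp, Real.abs_exp, ← Real.exp_neg]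
  exact Real.exp_le_exp.2 (by nlinarith)

theorem tendsto_eval_mul_exp_neg_sq_atBot (p : Polynomial ℝ) :
    Filter.Tendsto (fun x => p.eval x * Real.exp (-(x ^ 2))) Filter.atBot (nhds 0) := by
  have := (tendsto_eval_mul_exp_neg_sq_atTop (p.comp (-Polynomial.X))).comp
    Filter.tendsto_neg_atBot_atTop
  simpa [Function.comp_def] using this

/-- Between two consecutive elements of `{-∞} ∪ (zeros of He_n) ∪ {∞}` lies a zero of
`He_(n+1)`. -/
theorem exists_mem_hermiteNodes_succ {n : ℕ} {x y : EReal} (hxy : x < y)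
    (hx : x = ⊥ ∨ ∃ a ∈ hermiteNodes n, (a : EReal) = x)
    (hy : y = ⊤ ∨ ∃ a ∈ hermiteNodes n, (a : EReal) = y) :
    ∃ z ∈ hermiteNodes (n + 1), x < (z : EReal) ∧ (z : EReal) < y := by
  set p := realHermite n with hp
  -- Since `G' = -2 p He_(n+1) exp (-t²)`, an interior maximum with `p ≠ 0` is a zero of `He_(n+1)`.
  -- The square makes `G` positive off the zeros of `p`, and it vanishes at both ends, at infinity
  -- in the limit.
  set G : ℝ → ℝ := fun t => (p ^ 2).eval t * Real.exp (-(t ^ 2)) with hG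
  obtain ⟨r, hxr, hry⟩ := EReal.lt_iff_exists_real_btwn.1 hxy
  obtain ⟨s, hrs, hsy⟩ := EReal.lt_iff_exists_real_btwn.1 hry
  obtain ⟨b, hb, hb0⟩ := exists_mem_Ioo_eval_ne_zero (realHermite_monic n).ne_zero
    (EReal.coe_lt_coe_iff.1 hrs)
  have hxb : x < b := hxr.trans (EReal.coe_lt_coe_iff.2 hb.1)
  have hby : (b : EReal) < y := (EReal.coe_lt_coe_iff.2 hb.2).trans hsy
  have hGb : 0 < G b := by
    have : p.eval b ≠ 0 := hb0
    simp only [hG, Polynomial.eval_pow]; positivity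
  have hzero : ∀ a ∈ hermiteNodes n, G a = 0 := fun a ha => by
    rw [mem_hermiteNodes] at ha
    simp [hG, hp, ha]
  obtain ⟨a, hxa, hab, hGa⟩ : ∃ a : ℝ, x ≤ a ∧ a < b ∧ G a < G b := by
    rcases hx with rfl | ⟨a, ha, rfl⟩
    · obtain ⟨a, h1, h2⟩ := (((tendsto_eval_mul_exp_neg_sq_atBot (p ^ 2)).eventually
        (gt_mem_nhds hGb)).and (Filter.eventually_lt_atBot b)).exists
      exact ⟨a, bot_le, h2, h1⟩
    · exact ⟨a, le_rfl, EReal.coe_lt_coe_iff.1 hxb, by rwa [hzero a ha]⟩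
  obtain ⟨c, hcy, hbc, hGc⟩ : ∃ c : ℝ, c ≤ y ∧ b < c ∧ G c < G b := by
    rcases hy with rfl | ⟨a, ha, rfl⟩
    · obtain ⟨a, h1, h2⟩ := (((tendsto_eval_mul_exp_neg_sq_atTop (p ^ 2)).eventually
        (gt_mem_nhds hGb)).and (Filter.eventually_gt_atTop b)).exists
      exact ⟨a, le_top, h2, h1⟩
    · exact ⟨a, le_rfl, EReal.coe_lt_coe_iff.1 hby, by rwa [hzero a ha]⟩
  have hcont : Continuous G := by fun_prop
  have hbm : b ∈ Set.Icc a c := ⟨hab.le, hbc.le⟩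
  obtain ⟨z, hz, hmax⟩ := isCompact_Icc.exists_isMaxOn ⟨b, hbm⟩ hcont.continuousOn
  have hGz : G b ≤ G z := hmax hbm
  have hza : a < z := lt_of_le_of_ne hz.1 (by rintro rfl; linarith)
  have hzc : z < c := lt_of_le_of_ne hz.2 (by rintro rfl; linarith)
  have hloc : IsLocalMax G z := by
    filter_upwards [Icc_mem_nhds hza hzc] with t ht using hmax ht
  have hder : HasDerivAt G (-2 * p.eval z * (realHermite (n + 1)).eval z *
      Real.exp (-(z ^ 2))) z := by
    have h1 : HasDerivAt (fun x : ℝ => -(x ^ 2)) (-(2 * z)) z := by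
      simpa using ((hasDerivAt_id' z).fun_pow 2).fun_neg
    refine (((p ^ 2).hasDerivAt z).fun_mul h1.exp).congr_deriv ?_
    rw [realHermite_succ]
    simp [Polynomial.derivative_pow, ← hp]
    ring
  have h0 := hloc.hasDerivAt_eq_zero hder
  have hpz : p.eval z ≠ 0 := fun h => by
    have : G z = 0 := by simp [hG, h]
    linarith
  refine ⟨z, ?_, hxa.trans_lt (EReal.coe_lt_coe_iff.2 hza),
    (EReal.coe_lt_coe_iff.2 hzc).trans_le hcy⟩
  rw [mem_hermiteNodes]
  simpa [hpz] using h0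

/-- The Hermite polynomial of degree `n` has `n` distinct real zeros. -/
theorem card_hermiteNodes (n : ℕ) : (hermiteNodes n).card = n := by
  refine le_antisymm ?_ ?_
  · calc (hermiteNodes n).card ≤ Multiset.card (realHermite n).roots :=
        Multiset.toFinset_card_le _
      _ ≤ n := by simpa [natDegree_realHermite] using (realHermite n).card_roots'
  induction n with
  | zero => simp
  | succ n ih =>
    set e : ℝ ↪ EReal := ⟨Real.toEReal, EReal.coe_injective⟩
    have hmem : ∀ {k : ℕ} {x : EReal}, x ∈ (hermiteNodes k).map e ↔
        ∃ a ∈ hermiteNodes k, (a : EReal) = x := by simp [e]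
    have hbot : ∀ k, (⊥ : EReal) ∉ (hermiteNodes k).map e := by simp [e]
    have htop : ∀ k, (⊤ : EReal) ∉ (hermiteNodes k).map e := by simp [e]
    -- With `±∞` adjoined there are at least `n + 2` points, and each of their gaps contains a zero
    -- of `He_(n+1)`.
    have := Finset.card_le_of_interleaved
      (s := insert ⊥ (insert ⊤ ((hermiteNodes n).map e))) (t := (hermiteNodes (n + 1)).map e) (by
        intro x hx y hy hxy _
        rw [Finset.mem_insert, Finset.mem_insert, hmem] at hx hy
        obtain ⟨z, hz, h1, h2⟩ := exists_mem_hermiteNodes_succ (n := n) hxy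
          (by rcases hx with h | h | h
              · exact Or.inl h
              · exact absurd hxy (by simp [h])
              · exact Or.inr h)
          (by rcases hy with h | h | h
              · exact absurd hxy (by simp [h])
              · exact Or.inl h
              · exact Or.inr h)
        exact ⟨z, hmem.2 ⟨z, hz, rfl⟩, h1, h2⟩)
    rw [Finset.card_insert_of_notMem (by simpa using hbot n),
      Finset.card_insert_of_notMem (htop n), Finset.card_map, Finset.card_map] at this
    omega

/-! ### The sparse-grid rule on functions of one coordinate. -/

theorem integrable_polynomial_gaussianReal (p : Polynomial ℝ) :
    Integrable (fun x => p.eval x) (gaussianReal 0 1) := by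
  induction p using Polynomial.induction_on' with
  | add p q hp hq => simpa using hp.fun_add hq
  | monomial n a =>
    simp only [Polynomial.eval_monomial]
    refine Integrable.const_mul ?_ a
    refine (integrable_norm_iff (by fun_prop)).1 ?_
    have := (memLp_id_gaussianReal (μ := 0) (v := 1) n).integrable_norm_pow'
    simpa using this

/-- The value `∑ w_ξ g(ξ)` of a quadrature functional, as a linear map of the functional. -/
theorem linearCombination_gaussHermite (n : ℕ) (g : ℝ → ℝ) :
    Finsupp.linearCombination ℝ g (gaussHermite n) = ∑ ξ ∈ hermiteNodes n,
      (∫ x, (Lagrange.basis (hermiteNodes n) id ξ).eval x ∂(gaussianReal 0 1)) * g ξ := by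
  simp [gaussHermite, map_sum]

theorem linearCombination_gaussHermite_one {n : ℕ} (hn : 1 ≤ n) :
    Finsupp.linearCombination ℝ (fun _ => (1 : ℝ)) (gaussHermite n) = 1 := by
  rw [linearCombination_gaussHermite]
  simp only [mul_one]
  rw [← integral_finsetSum _ fun ξ _ => integrable_polynomial_gaussianReal _]
  have hne : (hermiteNodes n).Nonempty := by
    rw [← Finset.card_pos, card_hermiteNodes]; omega
  simp only [← Polynomial.eval_finsetSum]
  rw [Lagrange.sum_basis Function.injective_id.injOn hne]
  simp

/-- Every `Q_ℓ` with `ℓ ≥ 1` is exact on constants, whereas `Q_0 = 0`; hence the exception at `ℓ =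
1`. -/
theorem linearCombination_ruleDifference_one {n : ℕ → ℕ} (hn : ∀ ℓ, 1 ≤ ℓ → 1 ≤ n ℓ) {ℓ : ℕ}
    (hℓ : 1 ≤ ℓ) : Finsupp.linearCombination ℝ (fun _ => (1 : ℝ)) (ruleDifference n ℓ) =
      if ℓ = 1 then 1 else 0 := by
  obtain ⟨k, rfl⟩ := Nat.exists_eq_add_of_le' hℓ
  rcases k with _ | k
  · simp [ruleDifference, univariateRule, linearCombination_gaussHermite_one (hn 1 le_rfl)]
  · simp [ruleDifference, univariateRule, linearCombination_gaussHermite_one (hn (k + 1) (by omega)),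
      linearCombination_gaussHermite_one (hn (k + 1 + 1) (by omega))]

theorem sum_ruleDifference (n : ℕ → ℕ) (K : ℕ) :
    ∑ ℓ ∈ Finset.Icc 1 K, ruleDifference n ℓ = univariateRule n K := by
  induction K with
  | zero => simp [univariateRule]
  | succ K ih =>
    rw [Finset.sum_Icc_succ_top (by omega), ih]
    simp [ruleDifference]

theorem tensorRule_comp_zero {d : ℕ} (T : Fin (d + 1) → ℝ →₀ ℝ) (g : ℝ → ℝ) :
    tensorRule T (fun x => g (x 0)) = Finsupp.linearCombination ℝ g (T 0) *
      ∏ k : Fin d, Finsupp.linearCombination ℝ (fun _ => (1 : ℝ)) (T k.succ) := by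
  have := tensorRule_prod T (Fin.cons g fun _ _ => 1)
  simpa [Fin.prod_univ_succ, Finsupp.linearCombination_apply, smul_eq_mul] using this

/-- On functions of one coordinate the sparse-grid rule is a univariate rule. -/
theorem sparseGridRule_comp_zero {d : ℕ} {n : ℕ → ℕ} (hn : ∀ ℓ, 1 ≤ ℓ → 1 ≤ n ℓ) {L : ℕ}
    (hL : d + 1 ≤ L) (g : ℝ → ℝ) :
    sparseGridRule n (isotropicIndexSet (d + 1) L) (fun x => g (x 0)) =
      Finsupp.linearCombination ℝ g (gaussHermite (n (L - d))) := by
  have hmem : ∀ ℓ : Fin (d + 1) → ℕ, ℓ ∈ isotropicIndexSet (d + 1) L ↔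
      (∀ k, 1 ≤ ℓ k ∧ ℓ k ≤ L) ∧ ∑ k, ℓ k ≤ L := by
    intro ℓ; simp [isotropicIndexSet]
  have h1 : sparseGridRule n (isotropicIndexSet (d + 1) L) (fun x => g (x 0)) =
      ∑ ℓ ∈ isotropicIndexSet (d + 1) L, if ∀ k : Fin d, ℓ k.succ = 1 then
        Finsupp.linearCombination ℝ g (ruleDifference n (ℓ 0)) else 0 := by
    refine Finset.sum_congr rfl fun ℓ hℓ => ?_
    rw [hmem] at hℓ
    rw [tensorRule_comp_zero, Finset.prod_congr rfl fun k _ =>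
      linearCombination_ruleDifference_one hn (hℓ.1 k.succ).1]
    by_cases h : ∀ k : Fin d, ℓ k.succ = 1
    · simp [h]
    · obtain ⟨k, hk⟩ := not_forall.1 h
      rw [if_neg h, Finset.prod_eq_zero (Finset.mem_univ k) (if_neg hk), mul_zero]
  rw [h1, ← Finset.sum_filter]
  have h2 : gaussHermite (n (L - d)) = univariateRule n (L - d) := by
    rw [univariateRule, if_neg (by omega)]
  rw [h2, ← sum_ruleDifference, map_sum]
  -- The surviving indices are `(j, 1, …, 1)`. The `d` ones use up `d` of the budget `L`, leaving `1
  -- ≤ j ≤ L - d`.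
  refine Finset.sum_nbij' (fun ℓ => ℓ 0) (fun j => Fin.cons j fun _ => 1) ?_ ?_ ?_ ?_ ?_
  · intro ℓ hℓ
    rw [Finset.mem_filter, hmem, Fin.sum_univ_succ] at hℓ
    have := hℓ.1.2
    simp only [hℓ.2, Finset.sum_const, Finset.card_univ, Fintype.card_fin, smul_eq_mul,
      mul_one] at this
    rw [Finset.mem_Icc]
    exact ⟨(hℓ.1.1 0).1, by omega⟩
  · intro j hj
    rw [Finset.mem_Icc] at hj
    rw [Finset.mem_filter, hmem]
    refine ⟨⟨?_, ?_⟩, by simp⟩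
    · intro k
      refine Fin.cases ?_ (fun k => ?_) k
      · simp only [Fin.cons_zero]; omega
      · simp only [Fin.cons_succ]; omega
    · simp [Fin.sum_univ_succ]; omega
  · intro ℓ hℓ
    rw [Finset.mem_filter] at hℓ
    funext k
    refine Fin.cases ?_ (fun k => ?_) k
    · simp
    · simp [hℓ.2 k]
  · simp
  · simp

/-! ### Weak derivatives and Sobolev norms of functions of one coordinate. -/

theorem contDiff_partialDeriv {d : ℕ} {φ : (Fin d → ℝ) → ℝ} (hφ : ContDiff ℝ ∞ φ) (i : Fin d) :
    ContDiff ℝ ∞ (partialDeriv i φ) :=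
  (hφ.fderiv_right (m := ∞) (by simp)).clm_apply contDiff_const

theorem hasCompactSupport_partialDeriv {d : ℕ} {φ : (Fin d → ℝ) → ℝ}
    (hφ : HasCompactSupport φ) (i : Fin d) : HasCompactSupport (partialDeriv i φ) :=
  hφ.fderiv_apply ℝ (Pi.single i 1)

theorem contDiff_foldr_partialDeriv {d : ℕ} (r : Fin d → ℕ) {φ : (Fin d → ℝ) → ℝ}
    (hφ : ContDiff ℝ ∞ φ ∧ HasCompactSupport φ) (l : List (Fin d)) :
    ContDiff ℝ ∞ (l.foldr (fun i g => (partialDeriv i)^[r i] g) φ) ∧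
      HasCompactSupport (l.foldr (fun i g => (partialDeriv i)^[r i] g) φ) := by
  induction l with
  | nil => exact hφ
  | cons i l ih =>
    rw [List.foldr_cons]
    generalize r i = k
    induction k with
    | zero => exact ih
    | succ k ihk =>
      rw [Function.iterate_succ_apply']
      exact ⟨contDiff_partialDeriv ihk.1 i, hasCompactSupport_partialDeriv ihk.2 i⟩

theorem partialDeriv_comp_zero {d : ℕ} {h : ℝ → ℝ} (hh : ContDiff ℝ ∞ h) (i : Fin (d + 1))
    (x : Fin (d + 1) → ℝ) :
    partialDeriv i (fun x => h (x 0)) x = if i = 0 then deriv h (x 0) else 0 := by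
  have h1 : HasFDerivAt (fun x : Fin (d + 1) → ℝ => h (x 0))
      (deriv h (x 0) • ContinuousLinearMap.proj (R := ℝ) (φ := fun _ : Fin (d + 1) => ℝ) 0) x :=
    ((hh.differentiable (by simp)) (x 0)).hasDerivAt.comp_hasFDerivAt x
      (ContinuousLinearMap.proj (R := ℝ) (φ := fun _ : Fin (d + 1) => ℝ) 0).hasFDerivAt
  rw [partialDeriv, h1.fderiv]
  by_cases hi : i = 0
  · subst hi; simp
  · simp [hi]

theorem integral_mul_partialDeriv {d : ℕ} {f ψ : (Fin d → ℝ) → ℝ} (hf : ContDiff ℝ ∞ f)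
    (hψ : ContDiff ℝ ∞ ψ) (hc : HasCompactSupport ψ) (i : Fin d) :
    ∫ x, f x * partialDeriv i ψ x = -∫ x, partialDeriv i f x * ψ x := by
  have hψ' := contDiff_partialDeriv hψ i
  have hf' := contDiff_partialDeriv hf i
  refine integral_mul_fderiv_eq_neg_fderiv_mul_of_integrable (v := Pi.single i 1) ?_ ?_ ?_ ?_ ?_
  · exact (hf'.continuous.mul hψ.continuous).integrable_of_hasCompactSupport hc.mul_left
  · exact (hf.continuous.mul hψ'.continuous).integrable_of_hasCompactSupport
      (hasCompactSupport_partialDeriv hc i).mul_left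
  · exact (hf.continuous.mul hψ.continuous).integrable_of_hasCompactSupport hc.mul_left
  · intro x _; exact (hf.differentiable (by simp)) x
  · intro x _; exact (hψ.differentiable (by simp)) x

theorem contDiff_iteratedDeriv {h : ℝ → ℝ} (hh : ContDiff ℝ ∞ h) (k : ℕ) :
    ContDiff ℝ ∞ (iteratedDeriv k h) := by
  rw [iteratedDeriv_eq_iterate]
  exact hh.iterate_deriv k

theorem integral_comp_zero_mul_iterate_partialDeriv_zero {d : ℕ} {h : ℝ → ℝ}
    (hh : ContDiff ℝ ∞ h) {ψ : (Fin (d + 1) → ℝ) → ℝ} (hψ : ContDiff ℝ ∞ ψ)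
    (hc : HasCompactSupport ψ) (k : ℕ) :
    ∫ x, h (x 0) * (partialDeriv 0)^[k] ψ x = (-1) ^ k * ∫ x, iteratedDeriv k h (x 0) * ψ x := by
  induction k generalizing ψ with
  | zero => simp
  | succ k ih =>
    have hk : ContDiff ℝ ∞ (iteratedDeriv k h) := contDiff_iteratedDeriv hh _
    rw [Function.iterate_succ_apply, ih (contDiff_partialDeriv hψ 0)
      (hasCompactSupport_partialDeriv hc 0),
      integral_mul_partialDeriv (f := fun x => iteratedDeriv k h (x 0))
        (hk.comp (contDiff_apply ℝ ℝ 0)) hψ hc 0]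
    simp only [partialDeriv_comp_zero hk, if_true, ← iteratedDeriv_succ]
    ring

/-- Integration by parts moves a derivative in a coordinate other than `0` onto `h (x 0)`, where it
gives zero. -/
theorem integral_comp_zero_mul_foldr {d : ℕ} {h : ℝ → ℝ} (hh : ContDiff ℝ ∞ h)
    {φ : (Fin (d + 1) → ℝ) → ℝ} (hφ : ContDiff ℝ ∞ φ ∧ HasCompactSupport φ)
    (r : Fin (d + 1) → ℕ) (l : List (Fin (d + 1))) (hl : ∀ i ∈ l, i ≠ 0) :
    ∫ x, h (x 0) * l.foldr (fun i g => (partialDeriv i)^[r i] g) φ x =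
      if ∀ i ∈ l, r i = 0 then ∫ x, h (x 0) * φ x else 0 := by
  induction l with
  | nil => simp
  | cons i l ih =>
    rw [List.forall_mem_cons] at hl
    simp only [List.foldr_cons, List.forall_mem_cons]
    rcases hri : r i with _ | k
    · simpa using ih hl.2
    · rw [if_neg (by simp)]
      obtain ⟨h1, h2⟩ : ContDiff ℝ ∞ ((partialDeriv i)^[k]
          (l.foldr (fun i g => (partialDeriv i)^[r i] g) φ)) ∧ HasCompactSupport
          ((partialDeriv i)^[k] (l.foldr (fun i g => (partialDeriv i)^[r i] g) φ)) := by
        clear hri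
        induction k with
        | zero => exact contDiff_foldr_partialDeriv r hφ l
        | succ k ihk =>
          rw [Function.iterate_succ_apply']
          exact ⟨contDiff_partialDeriv ihk.1 i, hasCompactSupport_partialDeriv ihk.2 i⟩
      rw [Function.iterate_succ_apply', integral_mul_partialDeriv (f := fun x => h (x 0))
        (hh.comp (contDiff_apply ℝ ℝ 0)) h1 h2 i]
      simp [partialDeriv_comp_zero hh, hl.1]

/-- The weak derivatives of a smooth function of one coordinate. -/
theorem hasWeakDeriv_comp_zero {d : ℕ} {h : ℝ → ℝ} (hh : ContDiff ℝ ∞ h)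
    (r : Fin (d + 1) → ℕ) :
    HasWeakDeriv r (fun x => h (x 0)) (fun x => if ∀ k : Fin d, r k.succ = 0 then
      iteratedDeriv (r 0) h (x 0) else 0) := by
  have hk : ContDiff ℝ ∞ (iteratedDeriv (r 0) h) := contDiff_iteratedDeriv hh _
  refine ⟨(hh.continuous.comp (continuous_apply 0)).locallyIntegrable, ?_, ?_⟩
  · split_ifs
    · exact (hk.continuous.comp (continuous_apply 0)).locallyIntegrable
    · exact continuous_const.locallyIntegrable
  · intro φ hφ hc
    obtain ⟨h1, h2⟩ := contDiff_foldr_partialDeriv r ⟨hφ, hc⟩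
      ((List.finRange d).map Fin.succ)
    -- Coordinate `0` is outermost in `mixedDeriv`, so its derivatives are moved first and the other
    -- coordinates then meet `h^(r 0)`.
    rw [mixedDeriv, List.finRange_succ, List.foldr_cons,
      integral_comp_zero_mul_iterate_partialDeriv_zero hh h1 h2,
      integral_comp_zero_mul_foldr hk ⟨hφ, hc⟩ r _ (by simp)]
    simp only [List.forall_mem_map, List.mem_finRange, forall_const]
    by_cases hr : ∀ k : Fin d, r k.succ = 0
    · simp [hr, Fin.sum_univ_succ]
    · simp [hr]

/-- An infimum is bounded by any one candidate, so uniqueness of weak derivatives is not needed; the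
Gaussian measure has mass one, so a sup bound is an `L²` bound. -/
theorem weakDerivNorm_comp_zero_le {d : ℕ} {h : ℝ → ℝ} (hh : ContDiff ℝ ∞ h)
    (r : Fin (d + 1) → ℕ) {C : ℝ} (hC : ∀ t, |iteratedDeriv (r 0) h t| ≤ C) :
    weakDerivNorm r (fun x => h (x 0)) ≤ ENNReal.ofReal C := by
  have : IsProbabilityMeasure (gaussianMeasure (d + 1)) := by
    unfold gaussianMeasure; infer_instance
  refine (iInf₂_le _ (hasWeakDeriv_comp_zero hh r)).trans ?_
  refine (eLpNorm_le_of_ae_bound (C := C) (Filter.Eventually.of_forall fun x => ?_)).trans ?_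
  · split_ifs
    · exact hC _
    · simpa using (abs_nonneg _).trans (hC 0)
  · simp

theorem sobolevNorm_comp_zero_le {d α : ℕ} {h : ℝ → ℝ} (hh : ContDiff ℝ ∞ h) {C : ℝ}
    (hC : ∀ k ≤ α, ∀ t, |iteratedDeriv k h t| ≤ C) :
    sobolevNorm α (fun x : Fin (d + 1) → ℝ => h (x 0)) ≤
      ENNReal.ofReal (Real.sqrt ((α + 1) ^ (d + 1)) * C) := by
  have hC0 : 0 ≤ C := (abs_nonneg _).trans (hC 0 (Nat.zero_le _) 0)
  have hsum : ∑ r ∈ Fintype.piFinset (fun _ : Fin (d + 1) => Finset.range (α + 1)),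
      weakDerivNorm r (fun x : Fin (d + 1) → ℝ => h (x 0)) ^ 2 ≤
        ENNReal.ofReal ((α + 1) ^ (d + 1) * C ^ 2) := by
    refine (Finset.sum_le_card_nsmul _ _ (ENNReal.ofReal C ^ 2) fun r hr => ?_).trans_eq ?_
    · rw [Fintype.mem_piFinset] at hr
      gcongr
      exact weakDerivNorm_comp_zero_le hh r (hC _ (Nat.lt_succ_iff.1 (Finset.mem_range.1 (hr 0))))
    · rw [nsmul_eq_mul, ENNReal.ofReal_mul (by positivity), ENNReal.ofReal_pow hC0,
        ENNReal.ofReal_pow (by positivity)]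
      have : ENNReal.ofReal ((α : ℝ) + 1) = (α : ℝ≥0∞) + 1 := by
        rw [ENNReal.ofReal_add (by positivity) zero_le_one]; simp
      simp [this]
  rw [sobolevNorm]
  refine (ENNReal.rpow_le_rpow hsum (by norm_num)).trans_eq ?_
  rw [ENNReal.ofReal_rpow_of_nonneg (by positivity) (by norm_num), ← Real.sqrt_eq_rpow,
    Real.sqrt_mul (by positivity), Real.sqrt_sq hC0]

/-! ### Fooling functions and the error bound in terms of the univariate rule. -/

/-- A bump function on the unit interval. -/
theorem exists_smooth_bump (α : ℕ) : ∃ (φ : ℝ → ℝ) (B : ℝ), ContDiff ℝ ∞ φ ∧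
    HasCompactSupport φ ∧ (∀ t, 0 ≤ φ t) ∧ 0 < ∫ t, φ t ∧
    (∀ k t, iteratedDeriv k φ t ≠ 0 → 0 < t ∧ t < 1) ∧ 0 < B ∧
    ∀ k ≤ α, ∀ t, |iteratedDeriv k φ t| ≤ B := by
  -- An outer radius below `1/2` puts the closed support inside the open interval `(0, 1)`.
  set φ : ContDiffBump (1 / 2 : ℝ) := ⟨1 / 6, 1 / 3, by norm_num, by norm_num⟩ with hφ
  have hsmooth : ContDiff ℝ ∞ φ := φ.contDiff
  have hsupp : ∀ k t, iteratedDeriv k φ t ≠ 0 → t ∈ Metric.closedBall (1 / 2 : ℝ) (1 / 3) := by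
    intro k t ht
    by_contra hcon
    refine ht ?_
    have h0 : Set.EqOn (φ : ℝ → ℝ) (fun _ => 0) (Metric.closedBall (1 / 2 : ℝ) (1 / 3))ᶜ := by
      intro x hx
      rw [Set.mem_compl_iff, Metric.mem_closedBall, not_le] at hx
      exact φ.zero_of_le_dist hx.le
    have := h0.iteratedDeriv_of_isOpen Metric.isClosed_closedBall.isOpen_compl k hcon
    rw [this]
    simp
  have hbound : ∀ k, ∃ B, ∀ t, |iteratedDeriv k φ t| ≤ B := by
    intro k
    have hc : HasCompactSupport (iteratedDeriv k φ) :=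
      HasCompactSupport.intro (isCompact_closedBall (1 / 2 : ℝ) (1 / 3))
        fun t ht => by_contra fun h => ht (hsupp k t h)
    exact hc.exists_bound_of_continuous (contDiff_iteratedDeriv hsmooth k).continuous
  choose B hB using hbound
  have hB0 : ∀ k, 0 ≤ B k := fun k => (abs_nonneg _).trans (hB k 0)
  refine ⟨φ, ∑ k ∈ Finset.range (α + 1), B k + 1, hsmooth, φ.hasCompactSupport, fun _ => φ.nonneg,
    ?_, ?_, ?_, ?_⟩
  · exact φ.integral_pos
  · intro k t ht
    have := hsupp k t ht
    rw [Metric.mem_closedBall, Real.dist_eq, abs_le] at this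
    constructor <;> linarith
  · have := Finset.sum_nonneg fun k (_ : k ∈ Finset.range (α + 1)) => hB0 k
    linarith
  · intro k hk t
    have := Finset.single_le_sum (fun k _ => hB0 k)
      (Finset.mem_range.2 (Nat.lt_succ_of_le hk))
    linarith [hB k t]

/-- One half of each of `m` cells of `[0, 1]` contains no zero of the Hermite polynomial. -/
theorem exists_node_free_halves {n m : ℕ} (hm : (n : ℝ) + 1 ≤ (m : ℝ) ^ 2) :
    ∃ p : ℕ → ℕ, (∀ j, p j / 2 = j) ∧ ∀ j < m, ∀ ξ ∈ hermiteNodes n,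
      ¬ (0 < 2 * m * ξ - p j ∧ 2 * m * ξ - p j < 1) := by
  classical
  have hm0 : (0 : ℝ) < m := by
    have : (0 : ℝ) < (m : ℝ) ^ 2 := lt_of_lt_of_le (by positivity) hm
    exact lt_of_le_of_ne (Nat.cast_nonneg m) fun h => by simp [← h] at this
  -- Cell `j` has the halves `2j` and `2j + 1`; the right one is taken only if the left one contains
  -- a node. Nodes in both would be less than `1/m` apart, against the separation bound and `m² ≥ n
  -- + 1`.
  refine ⟨fun j => if ∃ ξ ∈ hermiteNodes n, 0 < 2 * m * ξ - (2 * j : ℕ) ∧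
    2 * m * ξ - (2 * j : ℕ) < 1 then 2 * j + 1 else 2 * j, fun j => ?_, fun j hj ξ hξ => ?_⟩
  · dsimp only
    split_ifs <;> omega
  · dsimp only
    split_ifs with h
    · obtain ⟨η, hη, h1, h2⟩ := h
      push_cast at h1 h2 ⊢
      rintro ⟨h3, h4⟩
      have hjm : (j : ℝ) + 1 ≤ m := by exact_mod_cast hj
      have hη0 : 0 < η := by
        have : 0 < 2 * (m : ℝ) * η := by linarith [(Nat.cast_nonneg j : (0 : ℝ) ≤ j)]
        exact pos_of_mul_pos_right this (by positivity)
      have hηξ : η < ξ := by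
        have : 2 * (m : ℝ) * η < 2 * m * ξ := by linarith
        exact lt_of_mul_lt_mul_left this (by positivity)
      have hξ1 : ξ ≤ 1 := by
        have : 2 * (m : ℝ) * ξ ≤ 2 * m * 1 := by linarith
        exact le_of_mul_le_mul_left this (by positivity)
      have hsep := one_le_mul_sq_of_mem_hermiteNodes hη0.le hηξ hξ1 hη hξ
      have hlt : (m : ℝ) * (ξ - η) < 1 := by linarith
      have hsq : ((m : ℝ) * (ξ - η)) ^ 2 < 1 :=
        pow_lt_one₀ (mul_nonneg hm0.le (by linarith)) hlt two_ne_zero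
      rw [mul_pow] at hsq
      nlinarith [sq_nonneg (ξ - η)]
    · exact fun h' => h ⟨ξ, hξ, h'⟩

theorem iteratedDeriv_sum_dilate {φ : ℝ → ℝ} (hφ : ContDiff ℝ ∞ φ) (m : ℕ) (p : ℕ → ℕ) (k : ℕ)
    (t : ℝ) : iteratedDeriv k (fun t => ∑ j ∈ Finset.range m, φ (2 * m * t - p j)) t =
      ∑ j ∈ Finset.range m, (2 * m : ℝ) ^ k * iteratedDeriv k φ (2 * m * t - p j) := by
  have hφk : ContDiff ℝ k φ := hφ.of_le (by exact_mod_cast le_top)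
  rw [iteratedDeriv_fun_sum fun j _ => by fun_prop]
  refine Finset.sum_congr rfl fun j _ => ?_
  rw [iteratedDeriv_comp_const_mul (f := fun s => φ (s - p j)) (by fun_prop) (2 * m : ℝ)]
  simp only [iteratedDeriv_comp_sub_const]

/-- The dilates live on disjoint half-cells, because `p j / 2 = j` makes `p` injective. So at most
one term is nonzero at `t`, and the bound does not pick up a factor `m`. -/
theorem abs_iteratedDeriv_sum_dilate_le {φ : ℝ → ℝ} (hφ : ContDiff ℝ ∞ φ) {k : ℕ} {B : ℝ}
    (hsupp : ∀ t, iteratedDeriv k φ t ≠ 0 → 0 < t ∧ t < 1)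
    (hB : ∀ t, |iteratedDeriv k φ t| ≤ B) (m : ℕ) {p : ℕ → ℕ} (hp : ∀ j, p j / 2 = j) (t : ℝ) :
    |iteratedDeriv k (fun t => ∑ j ∈ Finset.range m, φ (2 * m * t - p j)) t| ≤
      (2 * m : ℝ) ^ k * B := by
  rw [iteratedDeriv_sum_dilate hφ, ← Finset.mul_sum, abs_mul, abs_of_nonneg (by positivity)]
  refine mul_le_mul_of_nonneg_left ?_ (by positivity)
  by_cases h : ∃ j ∈ Finset.range m, iteratedDeriv k φ (2 * m * t - p j) ≠ 0
  · obtain ⟨j, hj, hne⟩ := h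
    rw [Finset.sum_eq_single_of_mem j hj fun i _ hij => ?_]
    · exact hB _
    by_contra hne'
    obtain ⟨h1, h2⟩ := hsupp _ hne
    obtain ⟨h3, h4⟩ := hsupp _ hne'
    have h5 : (p i : ℝ) < p j + 1 := by linarith
    have h6 : (p j : ℝ) < p i + 1 := by linarith
    have h7 : p i < p j + 1 := by exact_mod_cast h5
    have h8 : p j < p i + 1 := by exact_mod_cast h6
    have := hp i
    have := hp j
    have : p i = p j := by omega
    exact hij (by rw [← hp i, ← hp j, this])
  · push Not at h
    rw [Finset.sum_eq_zero h, abs_zero]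
    exact (abs_nonneg _).trans (hB 0)

theorem integral_sum_dilate {φ : ℝ → ℝ} (hφ : Continuous φ) (hc : HasCompactSupport φ) {m : ℕ}
    (hm : m ≠ 0) (p : ℕ → ℕ) :
    Integrable (fun t => ∑ j ∈ Finset.range m, φ (2 * m * t - p j)) ∧
    ∫ t, ∑ j ∈ Finset.range m, φ (2 * m * t - p j) = (∫ t, φ t) / 2 := by
  have hm' : (2 * m : ℝ) ≠ 0 := by positivity
  have hint : Integrable φ := hφ.integrable_of_hasCompactSupport hc
  have hint' : ∀ j ∈ Finset.range m, Integrable fun t => φ (2 * m * t - p j) := fun j _ =>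
    (hint.comp_sub_right (p j : ℝ)).comp_mul_left' hm'
  refine ⟨integrable_finsetSum _ hint', ?_⟩
  rw [integral_finsetSum _ hint']
  have : ∀ j ∈ Finset.range m, ∫ t, φ (2 * m * t - p j) = (2 * m : ℝ)⁻¹ * ∫ t, φ t := by
    intro j _
    rw [Measure.integral_comp_mul_left (fun s => φ (s - p j)), integral_sub_right_eq_self,
      abs_of_nonneg (by positivity), smul_eq_mul]
  rw [Finset.sum_congr rfl this]
  simp only [Finset.sum_const, Finset.card_range, nsmul_eq_mul]
  field_simp

theorem gaussianPDFReal_one_le {t : ℝ} (h0 : 0 ≤ t) (h1 : t ≤ 1) :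
    gaussianPDFReal 0 1 1 ≤ gaussianPDFReal 0 1 t := by
  have : t ^ 2 ≤ 1 := pow_le_one₀ h0 h1
  simp only [gaussianPDFReal, sub_zero]
  gcongr

theorem mul_integral_le_integral_gaussianReal {g : ℝ → ℝ} (hg : Integrable g)
    (hnonneg : ∀ t, 0 ≤ g t) (hsupp : ∀ t, g t ≠ 0 → 0 ≤ t ∧ t ≤ 1) :
    gaussianPDFReal 0 1 1 * ∫ t, g t ≤ ∫ t, g t ∂(gaussianReal 0 1) := by
  rw [integral_gaussianReal_eq_integral_smul one_ne_zero, ← integral_const_mul]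
  refine integral_mono (hg.const_mul _) ?_ fun t => ?_
  · refine hg.bdd_mul (c := gaussianPDFReal 0 1 0)
      (stronglyMeasurable_gaussianPDFReal 0 1).aestronglyMeasurable
      (Filter.Eventually.of_forall fun t => ?_)
    rw [Real.norm_eq_abs, abs_of_nonneg (gaussianPDFReal_nonneg _ _ _)]
    simp only [gaussianPDFReal, sub_zero]
    refine mul_le_mul_of_nonneg_left (Real.exp_le_exp.2 ?_) (by positivity)
    rw [NNReal.coe_one]
    linarith [sq_nonneg t]
  · by_cases h : g t = 0
    · simp [h]
    · exact mul_le_mul_of_nonneg_right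
        (gaussianPDFReal_one_le (hsupp t h).1 (hsupp t h).2) (hnonneg t)

/-- Fooling functions for Gauss–Hermite rules. -/
theorem exists_fooling_function (α : ℕ) : ∃ c C : ℝ, 0 < c ∧ 0 < C ∧ ∀ n : ℕ, 1 ≤ n →
    ∃ g : ℝ → ℝ, ContDiff ℝ ∞ g ∧ (∀ ξ ∈ hermiteNodes n, g ξ = 0) ∧
      c ≤ ∫ t, g t ∂(gaussianReal 0 1) ∧
      ∀ k ≤ α, ∀ t, |iteratedDeriv k g t| ≤ C * (n : ℝ) ^ ((α : ℝ) / 2) := by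
  obtain ⟨φ, B, hφ, hc, hnonneg, hpos, hsupp, hB0, hB⟩ := exists_smooth_bump α
  refine ⟨gaussianPDFReal 0 1 1 * ((∫ t, φ t) / 2), 6 ^ α * B,
    mul_pos (gaussianPDFReal_pos 0 1 1 one_ne_zero) (by linarith), by positivity, fun n hn => ?_⟩
  -- Large enough for `m² ≥ n + 1`, small enough for `2m ≤ 6 √n`, which is the source of the
  -- constant `6 ^ α`.
  set m := ⌈Real.sqrt (n + 1)⌉₊ with hm
  have hn' : (1 : ℝ) ≤ n := by exact_mod_cast hn
  have hm_le : Real.sqrt (n + 1) ≤ m := Nat.le_ceil _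
  have hm_sq : (n : ℝ) + 1 ≤ (m : ℝ) ^ 2 := by
    rw [← Real.sqrt_le_left (Nat.cast_nonneg m)]; exact hm_le
  have hm_one : (1 : ℝ) ≤ m := le_trans (Real.one_le_sqrt.2 (by linarith)) hm_le
  have hm_lt : (m : ℝ) ≤ 3 * Real.sqrt n := by
    have h1 : (m : ℝ) < Real.sqrt (n + 1) + 1 := Nat.ceil_lt_add_one (Real.sqrt_nonneg _)
    have h2 : Real.sqrt (n + 1) ≤ 2 * Real.sqrt n := by
      rw [Real.sqrt_le_left (by positivity), mul_pow, Real.sq_sqrt (by positivity)]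
      linarith
    have h3 : 1 ≤ Real.sqrt n := Real.one_le_sqrt.2 hn'
    linarith
  obtain ⟨p, hp, hfree⟩ := exists_node_free_halves hm_sq
  have hφ0 : ∀ t, φ t ≠ 0 → 0 < t ∧ t < 1 := fun t ht => hsupp 0 t (by simpa using ht)
  have hm0 : m ≠ 0 := by rintro h; rw [h] at hm_one; norm_num at hm_one
  obtain ⟨hint, hval⟩ := integral_sum_dilate hφ.continuous hc hm0 p
  refine ⟨fun t => ∑ j ∈ Finset.range m, φ (2 * m * t - p j), by fun_prop, ?_, ?_, ?_⟩
  · intro ξ hξ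
    refine Finset.sum_eq_zero fun j hj => ?_
    by_contra h
    exact hfree j (Finset.mem_range.1 hj) ξ hξ (hφ0 _ h)
  · rw [← hval]
    refine mul_integral_le_integral_gaussianReal hint
      (fun t => Finset.sum_nonneg fun j _ => hnonneg _) fun t ht => ?_
    obtain ⟨j, hj, hne⟩ := Finset.exists_ne_zero_of_sum_ne_zero ht
    obtain ⟨h1, h2⟩ := hφ0 _ hne
    have hpj : p j + 1 ≤ 2 * m := by
      have := hp j
      have := Finset.mem_range.1 hj
      omega
    have hpj' : (p j : ℝ) + 1 ≤ 2 * m := by exact_mod_cast hpj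
    constructor
    · have : 0 ≤ 2 * (m : ℝ) * t := by linarith [(Nat.cast_nonneg (p j) : (0 : ℝ) ≤ p j)]
      exact nonneg_of_mul_nonneg_right this (by positivity)
    · have : 2 * (m : ℝ) * t ≤ 2 * m * 1 := by linarith
      exact le_of_mul_le_mul_left this (by positivity)
  · intro k hk t
    refine (abs_iteratedDeriv_sum_dilate_le hφ (hsupp k) (hB k hk) m hp t).trans ?_
    have h1 : (2 * m : ℝ) ^ k ≤ (2 * m : ℝ) ^ α := pow_le_pow_right₀ (by linarith) hk
    have h2 : (2 * m : ℝ) ^ α ≤ (6 * Real.sqrt n) ^ α :=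
      pow_le_pow_left₀ (by positivity) (by linarith) α
    have h3 : (6 * Real.sqrt n) ^ α = 6 ^ α * (n : ℝ) ^ ((α : ℝ) / 2) := by
      rw [mul_pow, Real.sqrt_eq_rpow, ← Real.rpow_mul_natCast (by positivity)]
      congr 2
      ring
    calc (2 * m : ℝ) ^ k * B ≤ (6 ^ α * (n : ℝ) ^ ((α : ℝ) / 2)) * B :=
          mul_le_mul_of_nonneg_right (h1.trans (h2.trans h3.le)) hB0.le
      _ = _ := by ring

/-- The error of the sparse-grid rule is at least that of the univariate rule of highest level. -/
theorem exists_le_worstCaseError (d α : ℕ) : ∃ c : ℝ, 0 < c ∧ ∀ n : ℕ → ℕ,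
    (∀ ℓ, 1 ≤ ℓ → 1 ≤ n ℓ) → ∀ L : ℕ, d + 1 ≤ L →
      ENNReal.ofReal (c * (n (L - d) : ℝ) ^ (-(α : ℝ) / 2)) ≤
        worstCaseError α (sparseGridRule n (isotropicIndexSet (d + 1) L)) := by
  obtain ⟨c, C, hc, hC, hfool⟩ := exists_fooling_function α
  have hS : 0 < Real.sqrt ((α + 1) ^ (d + 1)) := Real.sqrt_pos.2 (by positivity)
  refine ⟨c / (Real.sqrt ((α + 1) ^ (d + 1)) * C), by positivity, fun n hn L hL => ?_⟩
  have hnL : 1 ≤ n (L - d) := hn _ (by omega)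
  obtain ⟨g, hg, hg0, hgI, hgD⟩ := hfool _ hnL
  have hnpos : (0 : ℝ) < n (L - d) := by exact_mod_cast hnL
  have hnorm := sobolevNorm_comp_zero_le (d := d) hg hgD
  have hI : gaussianIntegral (fun x : Fin (d + 1) → ℝ => g (x 0)) =
      ∫ t, g t ∂(gaussianReal 0 1) :=
    integral_comp_eval (μ := fun _ : Fin (d + 1) => gaussianReal 0 1) (i := 0)
      hg.continuous.aestronglyMeasurable
  have hrule : sparseGridRule n (isotropicIndexSet (d + 1) L) (fun x => g (x 0)) = 0 := by
    rw [sparseGridRule_comp_zero hn hL, linearCombination_gaussHermite]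
    exact Finset.sum_eq_zero fun ξ hξ => by rw [hg0 ξ hξ, mul_zero]
  have hmem : (fun x : Fin (d + 1) → ℝ => g (x 0)) ∈ {f ∈ sobolevSpace (d + 1) α | f ≠ 0} := by
    refine ⟨⟨hg.continuous.comp (continuous_apply 0), hnorm.trans_lt ENNReal.ofReal_lt_top⟩,
      fun h0 => ?_⟩
    rw [h0] at hI
    simp only [gaussianIntegral, Pi.zero_apply, integral_zero] at hI
    linarith
  refine le_trans ?_ (le_iSup₂ (f := fun f _ => ENNReal.ofReal |gaussianIntegral f -
    sparseGridRule n (isotropicIndexSet (d + 1) L) f| / sobolevNorm α f) _ hmem)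
  rw [hI, hrule, sub_zero]
  refine le_trans ?_ (ENNReal.div_le_div (ENNReal.ofReal_le_ofReal (hgI.trans (le_abs_self _)))
    hnorm)
  rw [← ENNReal.ofReal_div_of_pos (by positivity)]
  refine ENNReal.ofReal_le_ofReal (le_of_eq ?_)
  rw [neg_div, Real.rpow_neg hnpos.le]
  field_simp

/-! ### Counting the points of the sparse grid. -/

theorem mem_isotropicIndexSet {d L : ℕ} {ℓ : Fin d → ℕ} :
    ℓ ∈ isotropicIndexSet d L ↔ (∀ k, 1 ≤ ℓ k) ∧ ∑ k, ℓ k ≤ L := by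
  simp only [isotropicIndexSet, Finset.mem_filter, Fintype.mem_piFinset, Finset.mem_Icc]
  refine ⟨fun h => ⟨fun k => (h.1 k).1, h.2⟩, fun h => ⟨fun k => ⟨h.1 k, ?_⟩, h.2⟩⟩
  exact (Finset.single_le_sum (fun i _ => Nat.zero_le (ℓ i)) (Finset.mem_univ k)).trans h.2

/-- The nodes of level `s * j` that are not nodes of a level `s * i` with `1 ≤ i < j`. -/
noncomputable def newNodes (n : ℕ → ℕ) (s j : ℕ) : Finset ℝ :=
  hermiteNodes (n (s * j)) \ (Finset.Ico 1 j).biUnion fun i => hermiteNodes (n (s * i))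

theorem eq_of_mem_newNodes {n : ℕ → ℕ} {s i j : ℕ} (hi : 1 ≤ i) (hj : 1 ≤ j) {x : ℝ}
    (hxi : x ∈ newNodes n s i) (hxj : x ∈ newNodes n s j) : i = j := by
  have key : ∀ {i j : ℕ}, 1 ≤ i → x ∈ newNodes n s i → x ∈ newNodes n s j → ¬ i < j := by
    intro i j hi hxi hxj hij
    rw [newNodes, Finset.mem_sdiff] at hxi hxj
    exact hxj.2 (Finset.mem_biUnion.2 ⟨i, Finset.mem_Ico.2 ⟨hi, hij⟩, hxi.1⟩)
  have h1 := key hi hxi hxj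
  have h2 := key hj hxj hxi
  omega

theorem sum_Ico_pow_le {q : ℝ} (hq : 2 ≤ q) (j : ℕ) :
    ∑ i ∈ Finset.Ico 1 j, q ^ i ≤ 2 / q * q ^ j := by
  induction j with
  | zero => simp; positivity
  | succ j ih =>
    rcases Nat.eq_zero_or_pos j with rfl | hj
    · simp; positivity
    rw [Finset.sum_Ico_succ_top hj]
    have h1 : 2 / q * q ^ (j + 1) = 2 * q ^ j := by field_simp; ring
    have h2 : 2 / q * q ^ j ≤ 1 * q ^ j :=
      mul_le_mul_of_nonneg_right ((div_le_one (by linarith)).2 hq) (by positivity)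
    linarith

/-- Level `s * j` has at least `M^(sj) / M` nodes, and the levels `s * i` with `i < j` together have
at most `2 M₀ M^(sj) / M^s`, which is at most half of that by `hsM`. Steps of length `s` are needed
because the `n ℓ` need not increase from one level to the next. -/
theorem le_card_newNodes {M M₀ : ℝ} (hM : 1 < M) (hM₀ : 0 < M₀) {n : ℕ → ℕ}
    (hn : ∀ ℓ : ℕ, 1 ≤ ℓ → M ^ (ℓ - 1) ≤ (n ℓ : ℝ) ∧ (n ℓ : ℝ) ≤ M₀ * (M ^ ℓ - 1))
    {s j : ℕ} (hs : 1 ≤ s) (hs2 : 2 ≤ M ^ s) (hsM : 4 * M * M₀ ≤ M ^ s) (hj : 1 ≤ j) :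
    (2 * M)⁻¹ * M ^ (s * j) ≤ ((newNodes n s j).card : ℝ) := by
  have hM' : 0 < M := by linarith
  have h1 : (n (s * j) : ℝ) ≤ (newNodes n s j).card +
      ∑ i ∈ Finset.Ico 1 j, (n (s * i) : ℝ) := by
    have h := Finset.le_card_sdiff ((Finset.Ico 1 j).biUnion fun i => hermiteNodes (n (s * i)))
      (hermiteNodes (n (s * j)))
    have h' := Finset.card_biUnion_le (s := Finset.Ico 1 j)
      (t := fun i => hermiteNodes (n (s * i)))
    simp only [card_hermiteNodes] at h h'
    have : n (s * j) ≤ (newNodes n s j).card + ∑ i ∈ Finset.Ico 1 j, n (s * i) := by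
      rw [newNodes]; omega
    exact_mod_cast this
  have h2 : ∑ i ∈ Finset.Ico 1 j, (n (s * i) : ℝ) ≤ M₀ * (2 / M ^ s * M ^ (s * j)) := by
    calc ∑ i ∈ Finset.Ico 1 j, (n (s * i) : ℝ) ≤ ∑ i ∈ Finset.Ico 1 j, M₀ * (M ^ s) ^ i := by
          refine Finset.sum_le_sum fun i hi => ?_
          have hi1 := (Finset.mem_Ico.1 hi).1
          refine (hn (s * i) (Nat.mul_pos hs hi1)).2.trans ?_
          rw [← pow_mul]
          exact mul_le_mul_of_nonneg_left (by linarith) hM₀.le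
      _ ≤ _ := by
          rw [← Finset.mul_sum, pow_mul]
          exact mul_le_mul_of_nonneg_left (sum_Ico_pow_le hs2 j) hM₀.le
  have h3 := (hn (s * j) (Nat.mul_pos hs hj)).1
  have h4 : M ^ (s * j - 1) = M⁻¹ * M ^ (s * j) := by
    rw [← mul_pow_sub_one (Nat.mul_pos hs hj).ne' M, inv_mul_cancel_left₀ hM'.ne']
  have h5 : M₀ * (2 / M ^ s * M ^ (s * j)) ≤ (2 * M)⁻¹ * M ^ (s * j) := by
    rw [← mul_assoc]
    refine mul_le_mul_of_nonneg_right ?_ (by positivity)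
    rw [mul_div_assoc', div_le_iff₀ (by positivity), inv_mul_eq_div, le_div_iff₀ (by positivity)]
    linarith
  have h6 : (2 * M)⁻¹ * M ^ (s * j) + (2 * M)⁻¹ * M ^ (s * j) = M⁻¹ * M ^ (s * j) := by
    field_simp; norm_num
  linarith

/-- Products of new nodes over different multi-indices are disjoint. With level sum `s * K` each has
at least a constant times `M^(sK)` points, and there are `⌊K/(d+1)⌋^d` such multi-indices. -/
theorem le_card_sparseGrid_of_step {d : ℕ} {M M₀ : ℝ} (hM : 1 < M) (hM₀ : 0 < M₀) {n : ℕ → ℕ}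
    (hn : ∀ ℓ : ℕ, 1 ≤ ℓ → M ^ (ℓ - 1) ≤ (n ℓ : ℝ) ∧ (n ℓ : ℝ) ≤ M₀ * (M ^ ℓ - 1))
    {s : ℕ} (hs : 1 ≤ s) (hs2 : 2 ≤ M ^ s) (hsM : 4 * M * M₀ ≤ M ^ s) {K L : ℕ}
    (hK : d + 1 ≤ K) (hL : s * K ≤ L) :
    ((K / (d + 1) : ℕ) : ℝ) ^ d * ((2 * M)⁻¹ ^ (d + 1) * M ^ (s * K)) ≤
      ((sparseGrid n (isotropicIndexSet (d + 1) L)).card : ℝ) := by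
  set P := K / (d + 1) with hP
  have hP1 : 1 ≤ P := (Nat.one_le_div_iff (by omega)).2 hK
  have hPK : P * (d + 1) ≤ K := Nat.div_mul_le_self K (d + 1)
  set I : Finset (Fin d → ℕ) := Fintype.piFinset fun _ => Finset.Icc 1 P with hI
  -- The `d` free entries are at most `P`, so the first entry is at least `P ≥ 1` and the
  -- subtraction does not truncate.
  set J : (Fin d → ℕ) → Fin (d + 1) → ℕ := fun i => Fin.cons (K - ∑ k, i k) i with hJ
  have hsum_le : ∀ i ∈ I, ∑ k, i k ≤ d * P := fun i hi => by
    have := Finset.sum_le_card_nsmul Finset.univ i P fun k _ =>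
      (Finset.mem_Icc.1 (Fintype.mem_piFinset.1 hi k)).2
    simpa using this
  have hPd : d * P + P ≤ K := by linarith
  have hJ1 : ∀ i ∈ I, ∀ k, 1 ≤ J i k := by
    intro i hi k
    refine Fin.cases ?_ (fun k => ?_) k
    · have := hsum_le i hi
      simp only [hJ, Fin.cons_zero]; omega
    · simpa [hJ] using (Finset.mem_Icc.1 (Fintype.mem_piFinset.1 hi k)).1
  have hJsum : ∀ i ∈ I, ∑ k, J i k = K := by
    intro i hi
    have := hsum_le i hi
    simp only [hJ, Fin.sum_univ_succ, Fin.cons_zero, Fin.cons_succ]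
    omega
  set G : (Fin d → ℕ) → Finset (Fin (d + 1) → ℝ) := fun i =>
    Fintype.piFinset fun k => newNodes n s (J i k) with hG
  have hdisj : (I : Set (Fin d → ℕ)).PairwiseDisjoint G := by
    intro i hi i' hi' hne
    rw [Function.onFun, Finset.disjoint_left]
    intro x hx hx'
    rw [hG, Fintype.mem_piFinset] at hx hx'
    refine hne (funext fun k => ?_)
    have := eq_of_mem_newNodes (hJ1 i hi k.succ) (hJ1 i' hi' k.succ) (hx k.succ) (hx' k.succ)
    simpa [hJ] using this
  have hsub : I.biUnion G ⊆ sparseGrid n (isotropicIndexSet (d + 1) L) := by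
    intro x hx
    obtain ⟨i, hi, hx⟩ := Finset.mem_biUnion.1 hx
    refine Finset.mem_biUnion.2 ⟨fun k => s * J i k, ?_, ?_⟩
    · rw [mem_isotropicIndexSet]
      refine ⟨fun k => Nat.mul_pos hs (hJ1 i hi k), ?_⟩
      rw [← Finset.mul_sum, hJsum i hi]
      exact hL
    · rw [Fintype.mem_piFinset] at hx ⊢
      exact fun k => (Finset.mem_sdiff.1 (hx k)).1
  have hcard : ∀ i ∈ I, (2 * M)⁻¹ ^ (d + 1) * M ^ (s * K) ≤ ((G i).card : ℝ) := by
    intro i hi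
    have h1 : (2 * M)⁻¹ ^ (d + 1) * M ^ (s * K) =
        ∏ k : Fin (d + 1), ((2 * M)⁻¹ * M ^ (s * J i k)) := by
      rw [Finset.prod_mul_distrib, Finset.prod_pow_eq_pow_sum, ← Finset.mul_sum, hJsum i hi]
      simp
    rw [h1, hG, Fintype.card_piFinset, Nat.cast_prod]
    refine Finset.prod_le_prod (fun k _ => by positivity) fun k _ => ?_
    exact le_card_newNodes hM hM₀ hn hs hs2 hsM (hJ1 i hi k)
  calc ((P : ℕ) : ℝ) ^ d * ((2 * M)⁻¹ ^ (d + 1) * M ^ (s * K))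
      = I.card • ((2 * M)⁻¹ ^ (d + 1) * M ^ (s * K)) := by simp [hI]
    _ ≤ ∑ i ∈ I, ((G i).card : ℝ) := Finset.card_nsmul_le_sum _ _ _ hcard
    _ = ((I.biUnion G).card : ℝ) := by rw [Finset.card_biUnion hdisj]; simp
    _ ≤ _ := by exact_mod_cast Finset.card_le_card hsub

theorem one_le_of_growth {M M₀ : ℝ} (hM : 1 < M) {n : ℕ → ℕ}
    (hn : ∀ ℓ : ℕ, 1 ≤ ℓ → M ^ (ℓ - 1) ≤ (n ℓ : ℝ) ∧ (n ℓ : ℝ) ≤ M₀ * (M ^ ℓ - 1))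
    (ℓ : ℕ) (hℓ : 1 ≤ ℓ) : 1 ≤ n ℓ := by
  have : (1 : ℝ) ≤ n ℓ := (one_le_pow₀ hM.le).trans (hn ℓ hℓ).1
  exact_mod_cast this

theorem one_le_card_sparseGrid {d : ℕ} {n : ℕ → ℕ} (hn : ∀ ℓ, 1 ≤ ℓ → 1 ≤ n ℓ) {L : ℕ}
    (hL : d ≤ L) : 1 ≤ (sparseGrid n (isotropicIndexSet d L)).card := by
  have h1 : 0 < (hermiteNodes (n 1)).card := by
    rw [card_hermiteNodes]; exact hn 1 le_rfl
  obtain ⟨x, hx⟩ := Finset.card_pos.1 h1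
  refine Finset.card_pos.2 ⟨fun _ => x, Finset.mem_biUnion.2 ⟨fun _ => 1, ?_, ?_⟩⟩
  · rw [mem_isotropicIndexSet]
    simpa using hL
  · simpa using fun _ => hx

/-- The sparse grid has at least of order `M^L L^(d - 1)` distinct points. -/
theorem exists_le_card_sparseGrid (d : ℕ) {M M₀ : ℝ} (hM : 1 < M) (hM₀ : 0 < M₀) :
    ∃ c : ℝ, 0 < c ∧ ∀ n : ℕ → ℕ,
      (∀ ℓ : ℕ, 1 ≤ ℓ → M ^ (ℓ - 1) ≤ (n ℓ : ℝ) ∧ (n ℓ : ℝ) ≤ M₀ * (M ^ ℓ - 1)) →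
      ∀ L : ℕ, d + 1 ≤ L → c * ((L : ℝ) ^ d * M ^ L) ≤
        ((sparseGrid n (isotropicIndexSet (d + 1) L)).card : ℝ) := by
  have hM' : 0 < M := by linarith
  obtain ⟨s, hs⟩ : ∃ s : ℕ, max 2 (4 * M * M₀) < M ^ s := pow_unbounded_of_one_lt _ hM
  have hs2 : 2 ≤ M ^ s := (le_max_left _ _).trans hs.le
  have hsM : 4 * M * M₀ ≤ M ^ s := (le_max_right _ _).trans hs.le
  have hs1 : 1 ≤ s := Nat.one_le_iff_ne_zero.2 (by rintro rfl; norm_num at hs2)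
  set D : ℕ := s * (d + 1) with hD
  have hDpos : 1 ≤ D := Nat.mul_pos hs1 (by omega)
  have hDr : (0 : ℝ) < D := by exact_mod_cast hDpos
  -- For `L ≥ D`, rounding costs `⌊L/D⌋ ≥ L/(2D)` and `M^(s⌊L/s⌋) ≥ M^(L-s)`. The finitely many `L <
  -- D` are covered by `c₂`, since the grid is nonempty.
  set c₁ : ℝ := ((2 * D : ℝ)⁻¹) ^ d * ((2 * M)⁻¹ ^ (d + 1) * (M ^ s)⁻¹) with hc₁
  set c₂ : ℝ := ((D : ℝ) ^ d * M ^ D)⁻¹ with hc₂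
  have hc₁pos : 0 < c₁ := by positivity
  have hc₂pos : 0 < c₂ := by positivity
  refine ⟨min c₁ c₂, lt_min hc₁pos hc₂pos, fun n hn L hL => ?_⟩
  have hLnn : (0 : ℝ) ≤ L := Nat.cast_nonneg L
  rcases lt_or_ge L D with hLD | hLD
  · have h1 : (1 : ℝ) ≤ (sparseGrid n (isotropicIndexSet (d + 1) L)).card := by
      exact_mod_cast one_le_card_sparseGrid (one_le_of_growth hM hn) hL
    refine le_trans ?_ h1
    have h2 : (L : ℝ) ^ d * M ^ L ≤ (D : ℝ) ^ d * M ^ D := by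
      have hLD' : (L : ℝ) ≤ D := by exact_mod_cast hLD.le
      exact mul_le_mul (pow_le_pow_left₀ hLnn hLD' d) (pow_le_pow_right₀ hM.le hLD.le)
        (by positivity) (by positivity)
    calc min c₁ c₂ * ((L : ℝ) ^ d * M ^ L) ≤ c₂ * ((D : ℝ) ^ d * M ^ D) :=
          mul_le_mul (min_le_right _ _) h2 (by positivity) hc₂pos.le
      _ = 1 := inv_mul_cancel₀ (by positivity)
  · have hK : d + 1 ≤ L / s := by
      rw [Nat.le_div_iff_mul_le hs1, mul_comm]; exact hLD
    refine le_trans ?_ (le_card_sparseGrid_of_step hM hM₀ hn hs1 hs2 hsM hK (Nat.mul_div_le L s))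
    have h1 : (L : ℝ) * (2 * D : ℝ)⁻¹ ≤ ((L / s / (d + 1) : ℕ) : ℝ) := by
      rw [Nat.div_div_eq_div_mul, ← hD, ← div_eq_mul_inv, div_le_iff₀ (by positivity)]
      have h2 : L < D * (L / D) + D := by
        have := Nat.div_add_mod L D
        have := Nat.mod_lt L hDpos
        omega
      have h3 : 1 ≤ L / D := (Nat.one_le_div_iff hDpos).2 hLD
      have h4 : L ≤ (L / D) * (2 * D) := by nlinarith
      exact_mod_cast h4
    have h2 : M ^ L * (M ^ s)⁻¹ ≤ M ^ (s * (L / s)) := by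
      rw [← div_eq_mul_inv, div_le_iff₀ (by positivity), ← pow_add]
      refine pow_le_pow_right₀ hM.le ?_
      have := Nat.div_add_mod L s
      have := Nat.mod_lt L hs1
      omega
    calc min c₁ c₂ * ((L : ℝ) ^ d * M ^ L) ≤ c₁ * ((L : ℝ) ^ d * M ^ L) :=
          mul_le_mul_of_nonneg_right (min_le_left _ _) (by positivity)
      _ = ((L : ℝ) * (2 * D : ℝ)⁻¹) ^ d * ((2 * M)⁻¹ ^ (d + 1) * (M ^ L * (M ^ s)⁻¹)) := by
          rw [hc₁, mul_pow]; ring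
      _ ≤ _ := by
          refine mul_le_mul (pow_le_pow_left₀ (by positivity) h1 d) ?_ (by positivity)
            (by positivity)
          exact mul_le_mul_of_nonneg_left h2 (by positivity)

/-- One factor `L` is wasted by bounding all terms alike; this is harmless, as only the logarithm of
the count is used. -/
theorem evaluationCount_le {d : ℕ} {M M₀ : ℝ} (hM : 1 < M) (hM₀ : 0 < M₀) {n : ℕ → ℕ}
    (hn : ∀ ℓ : ℕ, 1 ≤ ℓ → M ^ (ℓ - 1) ≤ (n ℓ : ℝ) ∧ (n ℓ : ℝ) ≤ M₀ * (M ^ ℓ - 1)) (L : ℕ) :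
    (evaluationCount n (isotropicIndexSet d L) : ℝ) ≤ (L : ℝ) ^ d * (M₀ ^ d * M ^ L) := by
  have hM' : 0 < M := by linarith
  have hcard : (isotropicIndexSet d L).card ≤ L ^ d := by
    refine (Finset.card_filter_le _ _).trans ?_
    simp
  rw [evaluationCount, Nat.cast_sum]
  calc ∑ ℓ ∈ isotropicIndexSet d L, ((∏ k, n (ℓ k) : ℕ) : ℝ)
      ≤ (isotropicIndexSet d L).card • (M₀ ^ d * M ^ L) := by
        refine Finset.sum_le_card_nsmul _ _ _ fun ℓ hℓ => ?_
        rw [mem_isotropicIndexSet] at hℓ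
        rw [Nat.cast_prod]
        calc ∏ k, (n (ℓ k) : ℝ) ≤ ∏ k, (M₀ * M ^ ℓ k) := by
              refine Finset.prod_le_prod (fun k _ => Nat.cast_nonneg _) fun k _ => ?_
              exact (hn _ (hℓ.1 k)).2.trans (mul_le_mul_of_nonneg_left (by linarith) hM₀.le)
          _ = M₀ ^ d * M ^ ∑ k, ℓ k := by
              rw [Finset.prod_mul_distrib, Finset.prod_pow_eq_pow_sum]; simp
          _ ≤ _ := mul_le_mul_of_nonneg_left (pow_le_pow_right₀ hM.le hℓ.2) (by positivity)
    _ ≤ (L : ℝ) ^ d * (M₀ ^ d * M ^ L) := by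
        rw [nsmul_eq_mul]
        exact mul_le_mul_of_nonneg_right (by exact_mod_cast hcard) (by positivity)

theorem exists_log_le (d : ℕ) {M M₀ : ℝ} (hM : 1 < M) (hM₀ : 0 < M₀) :
    ∃ C : ℝ, 0 < C ∧ ∀ L : ℕ, 1 ≤ L → ∀ N : ℕ, 1 ≤ N →
      (N : ℝ) ≤ (L : ℝ) ^ d * (M₀ ^ d * M ^ L) → Real.log N ≤ C * L := by
  have hM' : 0 < M := by linarith
  have hlogM := Real.log_pos hM
  refine ⟨d + d * |Real.log M₀| + Real.log M, by positivity, fun L hL N hN h => ?_⟩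
  have hL' : (1 : ℝ) ≤ L := by exact_mod_cast hL
  have hN' : (0 : ℝ) < N := by exact_mod_cast hN
  have h1 := Real.log_le_log hN' h
  rw [Real.log_mul (by positivity) (by positivity), Real.log_mul (by positivity) (by positivity),
    Real.log_pow, Real.log_pow, Real.log_pow] at h1
  have h2 : (d : ℝ) * Real.log L ≤ d * L :=
    mul_le_mul_of_nonneg_left ((Real.log_le_sub_one_of_pos (by linarith)).trans (by linarith))
      (Nat.cast_nonneg d)
  have h3 : (d : ℝ) * Real.log M₀ ≤ d * |Real.log M₀| * L :=
    (mul_le_mul_of_nonneg_left (le_abs_self _) (Nat.cast_nonneg d)).trans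
      (le_mul_of_one_le_right (by positivity) hL')
  linarith

end GaussianSobolev

/-! ### Conclusion. -/

open GaussianSobolev in
/-- `N` is the number of function evaluations of the sparse-grid rule, where points shared by
several tensor grids may be counted once, with multiplicity, or in any way in between. -/
theorem theorem3p2 (d α : ℕ) (hd : 1 ≤ d) (hα : 1 ≤ α) (M M₀ : ℝ) (hM : 1 < M) (hM₀ : 0 < M₀) :
    ∃ c : ℝ, 0 < c ∧
      ∀ n : ℕ → ℕ,
        (∀ ℓ : ℕ, 1 ≤ ℓ → M ^ (ℓ - 1) ≤ (n ℓ : ℝ) ∧ (n ℓ : ℝ) ≤ M₀ * (M ^ ℓ - 1)) →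
        ∀ L : ℕ, d ≤ L → Real.exp ((d : ℝ) - 1) ≤ (n (L - d + 1) : ℝ) →
        ∀ N : ℕ, (sparseGrid n (isotropicIndexSet d L)).card ≤ N →
          N ≤ evaluationCount n (isotropicIndexSet d L) →
          ENNReal.ofReal (c * (N : ℝ) ^ (-(α : ℝ) / 2) *
              Real.log (N : ℝ) ^ ((α : ℝ) * ((d : ℝ) - 1) / 2)) ≤
            worstCaseError α (sparseGridRule n (isotropicIndexSet d L)) := by
  -- From here on the dimension is `d + 1`: the logarithm has exponent `α d / 2` and the relevant
  -- level is `L - d`.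
  obtain ⟨d, rfl⟩ := Nat.exists_eq_add_of_le' hd
  obtain ⟨c₀, hc₀, herror⟩ := exists_le_worstCaseError d α
  obtain ⟨c₁, hc₁, hcard⟩ := exists_le_card_sparseGrid d hM hM₀
  obtain ⟨C, hC, hlog⟩ := exists_log_le (d + 1) hM hM₀
  have hM' : 0 < M := by linarith
  -- Chosen so that `(ln N)^d n_(L-d) ≤ (C L)^d M₀ M^L = A c₁ L^d M^L ≤ A N`.
  set A : ℝ := C ^ d * M₀ / c₁ with hA
  have hApos : 0 < A := by positivity
  refine ⟨c₀ / A ^ ((α : ℝ) / 2), by positivity, fun n hn L hL _ N hN1 hN2 => ?_⟩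
  have hn1 := one_le_of_growth hM hn
  refine le_trans (ENNReal.ofReal_le_ofReal ?_) (herror n hn1 L hL)
  have hN : 1 ≤ N := (one_le_card_sparseGrid hn1 hL).trans hN1
  have hNpos : (0 : ℝ) < N := by exact_mod_cast hN
  have hLpos : (0 : ℝ) < L := by exact_mod_cast (by omega : 0 < L)
  have hnpos : (0 : ℝ) < n (L - d) := by exact_mod_cast hn1 (L - d) (by omega)
  have hlogN : 0 ≤ Real.log N := Real.log_natCast_nonneg N
  have h1 : c₁ * ((L : ℝ) ^ d * M ^ L) ≤ N := (hcard n hn L hL).trans (by exact_mod_cast hN1)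
  have h2 : Real.log N ≤ C * L := hlog L (by omega) N hN
    (le_trans (by exact_mod_cast hN2) (evaluationCount_le hM hM₀ hn L))
  have h3 : (n (L - d) : ℝ) ≤ M₀ * M ^ L := by
    refine (hn (L - d) (by omega)).2.trans (mul_le_mul_of_nonneg_left ?_ hM₀.le)
    have : M ^ (L - d) ≤ M ^ L := pow_le_pow_right₀ hM.le (by omega)
    linarith
  have h4 : (N : ℝ)⁻¹ * Real.log N ^ d ≤ A * (n (L - d) : ℝ)⁻¹ := by
    rw [inv_mul_eq_div, ← div_eq_mul_inv, div_le_div_iff₀ hNpos hnpos]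
    calc Real.log N ^ d * n (L - d) ≤ (C * L) ^ d * (M₀ * M ^ L) :=
          mul_le_mul (pow_le_pow_left₀ hlogN h2 d) h3 hnpos.le (by positivity)
      _ = A * (c₁ * ((L : ℝ) ^ d * M ^ L)) := by rw [hA, mul_pow]; field_simp
      _ ≤ A * N := mul_le_mul_of_nonneg_left h1 hApos.le
  have h5 : (N : ℝ) ^ (-(α : ℝ) / 2) * Real.log N ^ ((α : ℝ) * (((d + 1 : ℕ) : ℝ) - 1) / 2) =
      ((N : ℝ)⁻¹ * Real.log N ^ d) ^ ((α : ℝ) / 2) := by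
    rw [Real.mul_rpow (by positivity) (by positivity), Real.inv_rpow hNpos.le, neg_div,
      Real.rpow_neg hNpos.le, ← Real.rpow_natCast_mul hlogN]
    congr 2
    push_cast
    ring
  have h6 : (A * (n (L - d) : ℝ)⁻¹) ^ ((α : ℝ) / 2) =
      A ^ ((α : ℝ) / 2) * (n (L - d) : ℝ) ^ (-(α : ℝ) / 2) := by
    rw [Real.mul_rpow hApos.le (by positivity), Real.inv_rpow hnpos.le, neg_div,
      Real.rpow_neg hnpos.le]
  rw [mul_assoc, h5]
  calc c₀ / A ^ ((α : ℝ) / 2) * ((N : ℝ)⁻¹ * Real.log N ^ d) ^ ((α : ℝ) / 2)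
      ≤ c₀ / A ^ ((α : ℝ) / 2) * (A * (n (L - d) : ℝ)⁻¹) ^ ((α : ℝ) / 2) := by
        refine mul_le_mul_of_nonneg_left ?_ (by positivity)
        exact Real.rpow_le_rpow (by positivity) h4 (by positivity)
    _ = c₀ * (n (L - d) : ℝ) ^ (-(α : ℝ) / 2) := by
        rw [h6]
        have : A ^ ((α : ℝ) / 2) ≠ 0 := by positivity
        field_simp
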